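/- Let $d\ge 1$ and $m\ge 0$ be integers, let $\rho\in(-1,1)$, and let $X=(X_1,\dots,X_d)^\top$ and $Y=(Y_1,\dots,Y_d)^\top$ be random vectors in $\mathbb{R}^d$ such that $$(X_1,\dots,X_d,Y_1,\dots,Y_d)^\top\sim N_{2d}\big(0,\Sigma_{2d}(\rho)\big),\qquad \Sigma_{2d}(\rho)=\begin{pmatrix} I_d&\rho I_d\\ \rho I_d& I_d\end{pmatrix}.$$ Let $\langle\cdot,\cdot\rangle$ and $\|\cdot\|$ be the Euclidean inner product and norm on $\mathbb{R}^d$, and for $|z|<1$ let $${}_3F_2(a_1,a_2,a_3;b_1,b_2;z)=\sum_{n=0}^\infty\frac{(a_1)_n(a_2)_n(a_3)_n}{(b_1)_n(b_2)_n}\,\frac{z^n}{n!},\qquad (a)_n=a(a+1)\cdots(a+n-1).$$ In both formulas below the expectation exists and the series converges. (i) If $m$ is odd, then $$-1\le \mathbb{E}\Big[\Big\langle\frac{X}{\|X\|},\frac{Y}{\|Y\|}\Big\rangle^m\Big]=c_-(d,m)\,(1-\rho^2)^{d/2}\,\rho\;{}_3F_2\Big(\frac{d+1}{2},\frac{d+1}{2},\frac{m+2}{2};\frac32,\frac{m+d+1}{2};\rho^2\Big)\le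 1,$$ where $$c_-(d,m)=\frac{2}{\sqrt\pi}\,\frac{\Gamma\big(\frac{d+1}{2}\big)^2\,\Gamma\big(\frac{m+2}{2}\big)}{\Gamma\big(\frac d2\big)\,\Gamma\big(\frac{m+d+1}{2}\big)}.$$ (ii) If $m$ is even, then $$-1\le \mathbb{E}\Big[\Big\langle\frac{X}{\|X\|},\frac{Y}{\|Y\|}\Big\rangle^m\Big]=c_+(d,m)\,(1-\rho^2)^{d/2}\;{}_3F_2\Big(\frac d2,\frac d2,\frac{m+1}{2};\frac12,\frac{m+d}{2};\rho^2\Big)\le 1,$$ where $$c_+(d,m)=\frac{1}{\sqrt\pi}\,\frac{\Gamma\big(\frac d2\big)\,\Gamma\big(\frac{m+1}{2}\big)}{\Gamma\big(\frac{m+d}{2}\big)}.$$ -/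

import Mathlib

open MeasureTheory ProbabilityTheory

/-- The `2d × 2d` real correlation matrix with block form `[[I, ρ I], [ρ I, I]]`. -/
noncomputable def corrMatrix (d : ℕ) (ρ : ℝ) : Matrix (Fin d ⊕ Fin d) (Fin d ⊕ Fin d) ℝ :=
  Matrix.fromBlocks 1 (ρ • 1) (ρ • 1) 1

/-- The stacked vector `(x₁, …, x_d, y₁, …, y_d)`. -/
def stack {d : ℕ} (x y : EuclideanSpace ℝ (Fin d)) : EuclideanSpace ℝ (Fin d ⊕ Fin d) :=
  WithLp.toLp 2 (Sum.elim x.ofLp y.ofLp)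

/-- The `n`-th term
`(a₁)ₙ (a₂)ₙ (a₃)ₙ / ((b₁)ₙ (b₂)ₙ) * zⁿ / n!` of the hypergeometric series `₃F₂`,
where `(a)ₙ = a (a + 1) ⋯ (a + n - 1)` is the rising factorial. -/
noncomputable def hyp3F2Term (a₁ a₂ a₃ b₁ b₂ z : ℝ) (n : ℕ) : ℝ :=
  (ascPochhammer ℝ n).eval a₁ * (ascPochhammer ℝ n).eval a₂ * (ascPochhammer ℝ n).eval a₃ /
    ((ascPochhammer ℝ n).eval b₁ * (ascPochhammer ℝ n).eval b₂) * (z ^ n / (n.factorial : ℝ))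

/-- The generalized hypergeometric function `₃F₂(a₁, a₂, a₃; b₁, b₂; z)`. -/
noncomputable def hyp3F2 (a₁ a₂ a₃ b₁ b₂ z : ℝ) : ℝ :=
  ∑' n : ℕ, hyp3F2Term a₁ a₂ a₃ b₁ b₂ z n

/-- The constant in the formula for odd moments. -/
noncomputable def cMinus (d m : ℕ) : ℝ :=
  2 / √Real.pi *
    (Real.Gamma (((d : ℝ) + 1) / 2) ^ 2 * Real.Gamma (((m : ℝ) + 2) / 2) /
      (Real.Gamma ((d : ℝ) / 2) * Real.Gamma (((m : ℝ) + d + 1) / 2)))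

/-- The constant in the formula for even moments. -/
noncomputable def cPlus (d m : ℕ) : ℝ :=
  1 / √Real.pi *
    (Real.Gamma ((d : ℝ) / 2) * Real.Gamma (((m : ℝ) + 1) / 2) /
      Real.Gamma (((m : ℝ) + d) / 2))

/-- `⟨x / ‖x‖, y / ‖y‖⟩` in Euclidean space. -/
noncomputable def cosSim {d : ℕ} (x y : EuclideanSpace ℝ (Fin d)) : ℝ :=
  inner ℝ (‖x‖⁻¹ • x) (‖y‖⁻¹ • y)

/-- The right-hand side of the moment formula for odd `m`. -/
noncomputable def oddMoment (d m : ℕ) (ρ : ℝ) : ℝ :=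
  cMinus d m * (1 - ρ ^ 2) ^ ((d : ℝ) / 2) * ρ *
    hyp3F2 (((d : ℝ) + 1) / 2) (((d : ℝ) + 1) / 2) (((m : ℝ) + 2) / 2)
      (3 / 2) (((m : ℝ) + d + 1) / 2) (ρ ^ 2)

/-- The right-hand side of the moment formula for even `m`. -/
noncomputable def evenMoment (d m : ℕ) (ρ : ℝ) : ℝ :=
  cPlus d m * (1 - ρ ^ 2) ^ ((d : ℝ) / 2) *
    hyp3F2 ((d : ℝ) / 2) ((d : ℝ) / 2) (((m : ℝ) + 1) / 2)
      (1 / 2) (((m : ℝ) + d) / 2) (ρ ^ 2)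

/-! With `s = √(1 - ρ²)`, the pair is realised as `Y = ρX + sW` with `X`, `W` independent standard
Gaussians. The cosine is unchanged by positive dilations, so a linear change of variables
(`integral_shear_stdGaussian`) turns its `m`-th moment into `s^d` times the integral of `cos^m ·
exp(ρ⟨z, y⟩)` over an independent pair. Domination by `exp(|ρ|‖z‖‖y‖)`, integrable because `|ρ| <
1`, allows expansion of the exponential term by term (`hasSum_integral_cosSim_pow`).

For fixed `z`, the function `cos^m · ⟨z, y⟩^k` agrees on the unit sphere in `y` with `‖z‖^(-m) ⟨y,
z⟩^(k+m)`. By polar coordinates, Gaussian integrals of homogeneous functions agreeing on the sphere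
differ only by a ratio of radial Gamma factors. Each coefficient thus reduces to a one-dimensional
Gaussian moment of order `k + m` (`integral_cosSim_pow_mul_inner_pow`). It vanishes unless `k` and
`m` have the same parity; the surviving terms, rewritten with Pochhammer symbols, form the `₃F₂`
series. The bounds are Cauchy–Schwarz. -/

/-! ### Density of the standard Gaussian and the change of variables. -/

section StdGaussianDensity

variable {E : Type*} [NormedAddCommGroup E] [InnerProductSpace ℝ E]

/-- The density of the standard Gaussian measure with respect to the volume. -/
noncomputable def stdGaussianDensity (x : E) : ℝ :=
  (2 * Real.pi) ^ (-(Module.finrank ℝ E : ℝ) / 2) * Real.exp (-‖x‖ ^ 2 / 2)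

lemma stdGaussianDensity_pos (x : E) : 0 < stdGaussianDensity x := by
  unfold stdGaussianDensity; positivity

@[fun_prop]
lemma continuous_stdGaussianDensity : Continuous (stdGaussianDensity (E := E)) := by
  unfold stdGaussianDensity; fun_prop

variable [FiniteDimensional ℝ E] [MeasurableSpace E] [BorelSpace E]

lemma integrable_exp_neg_mul_sq_norm {b : ℝ} (hb : 0 < b) :
    Integrable (fun x : E => Real.exp (-b * ‖x‖ ^ 2)) := by
  have h := (GaussianFourier.integrable_cexp_neg_mul_sq_norm_add (b := (b : ℂ)) (by simpa) 0
    (0 : E)).re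
  refine h.congr (ae_of_all _ fun x => ?_)
  simp only [zero_mul, add_zero]
  rw [show -(b : ℂ) * (‖x‖ : ℂ) ^ 2 = ((-b * ‖x‖ ^ 2 : ℝ) : ℂ) by push_cast; rfl]
  exact Complex.exp_ofReal_re _

lemma integrable_stdGaussianDensity : Integrable (stdGaussianDensity (E := E)) := by
  unfold stdGaussianDensity
  refine Integrable.const_mul ?_ _
  convert! integrable_exp_neg_mul_sq_norm (E := E) (b := 1 / 2) (by norm_num) using 3
  ring

/-- Both are finite measures with the same characteristic function, by the Gaussian Fourier
integral. -/
lemma stdGaussian_eq_withDensity :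
    stdGaussian E = volume.withDensity fun x => ENNReal.ofReal (stdGaussianDensity x) := by
  have hfin : IsFiniteMeasure
      ((volume : Measure E).withDensity fun x => ENNReal.ofReal (stdGaussianDensity x)) :=
    isFiniteMeasure_withDensity_ofReal integrable_stdGaussianDensity.2
  refine Measure.ext_of_charFun (funext fun t => ?_)
  rw [charFun_stdGaussian, charFun_apply, integral_withDensity_eq_integral_toReal_smul
    (by fun_prop) (ae_of_all _ fun _ => ENNReal.ofReal_lt_top)]
  have h := GaussianFourier.integral_cexp_neg_mul_sq_norm_add (b := (1 / 2 : ℂ)) (by norm_num)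
    Complex.I t
  have hc : ((((2 * Real.pi) ^ (-(Module.finrank ℝ E : ℝ) / 2) : ℝ)) : ℂ) *
      ((Real.pi : ℂ) / (1 / 2 : ℂ)) ^ ((Module.finrank ℝ E : ℂ) / 2) = 1 := by
    rw [show (Real.pi : ℂ) / (1 / 2 : ℂ) = ((2 * Real.pi : ℝ) : ℂ) by push_cast; ring,
      show (Module.finrank ℝ E : ℂ) / 2 = (((Module.finrank ℝ E : ℝ) / 2 : ℝ) : ℂ) by push_cast; rfl,
      ← Complex.ofReal_cpow (by positivity), ← Complex.ofReal_mul, ← Real.rpow_add (by positivity)]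
    simp [neg_div]
  calc Complex.exp (-(‖t‖ : ℂ) ^ 2 / 2)
      = (((2 * Real.pi) ^ (-(Module.finrank ℝ E : ℝ) / 2) : ℝ) : ℂ) *
        ∫ v : E, Complex.exp (-(1 / 2 : ℂ) * (‖v‖ : ℂ) ^ 2 + Complex.I * (inner ℝ t v : ℝ)) := by
        rw [h, ← mul_assoc, hc, one_mul, Complex.I_sq]
        congr 1
        ring
    _ = _ := by
        rw [← integral_const_mul]
        refine integral_congr_ae (ae_of_all _ fun v => ?_)
        simp only [ENNReal.toReal_ofReal (stdGaussianDensity_pos v).le]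
        simp only [stdGaussianDensity, Complex.real_smul, Complex.ofReal_mul, Complex.ofReal_exp,
          Complex.exp_add, mul_assoc]
        rw [real_inner_comm, mul_comm Complex.I]
        congr 3
        push_cast
        ring

lemma integral_stdGaussian (f : E → ℝ) :
    ∫ x, f x ∂stdGaussian E = ∫ x, stdGaussianDensity x * f x := by
  rw [stdGaussian_eq_withDensity, integral_withDensity_eq_integral_toReal_smul
    (by fun_prop) (ae_of_all _ fun _ => ENNReal.ofReal_lt_top)]
  simp [ENNReal.toReal_ofReal (stdGaussianDensity_pos _).le]

lemma integrable_exp_mul_sq_norm_stdGaussian {c : ℝ} (hc : c < 1 / 2) :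
    Integrable (fun x => Real.exp (c * ‖x‖ ^ 2)) (stdGaussian E) := by
  rw [stdGaussian_eq_withDensity, integrable_withDensity_iff_integrable_smul'
    (by fun_prop) (ae_of_all _ fun _ => ENNReal.ofReal_lt_top)]
  simp only [ENNReal.toReal_ofReal (stdGaussianDensity_pos _).le]
  simp only [stdGaussianDensity, smul_eq_mul, mul_assoc, ← Real.exp_add]
  refine Integrable.const_mul ?_ _
  convert! integrable_exp_neg_mul_sq_norm (E := E) (b := 1 / 2 - c) (by linarith) using 3
  ring

/-- Shearing and rescaling a pair of independent standard Gaussian vectors: for functions that are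
invariant under positive dilations, correlation becomes an exponential weight. -/
lemma integral_shear_stdGaussian {ρ s : ℝ} (hs : 0 < s) (hρs : s ^ 2 + ρ ^ 2 = 1)
    (f : E → E → ℝ) (hf : ∀ x y, f (s • x) (s • y) = f x y) :
    ∫ z, ∫ w, f z (ρ • z + s • w) ∂stdGaussian E ∂stdGaussian E =
      s ^ Module.finrank ℝ E *
        ∫ z, ∫ y, f z y * Real.exp (ρ * inner ℝ z y) ∂stdGaussian E ∂stdGaussian E := by
  -- Only the outer variable is rescaled, giving the single factor `s^n`; the inner one is then
  -- shifted, `w = y - ρz`, so the arguments of `f` become `s • z` and `s • y`.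
  have hscale := Measure.integral_comp_smul_of_nonneg (volume : Measure E)
    (fun z => stdGaussianDensity z * ∫ w, f z (ρ • z + s • w) ∂stdGaussian E) s (hR := hs.le)
  rw [smul_eq_mul, eq_comm, inv_mul_eq_iff_eq_mul₀ (by positivity)] at hscale
  rw [integral_stdGaussian, hscale]
  congr 1
  rw [integral_stdGaussian]
  refine integral_congr_ae (ae_of_all _ fun z => ?_)
  simp only [integral_stdGaussian, ← integral_const_mul]
  rw [← integral_sub_right_eq_self _ (ρ • z)]
  refine integral_congr_ae (ae_of_all _ fun y => ?_)
  have harg : ρ • s • z + s • (y - ρ • z) = s • y := by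
    rw [smul_sub, smul_comm ρ s z]; abel
  have hexp : Real.exp (-‖s • z‖ ^ 2 / 2) * Real.exp (-‖y - ρ • z‖ ^ 2 / 2) =
      Real.exp (-‖z‖ ^ 2 / 2) * Real.exp (-‖y‖ ^ 2 / 2) * Real.exp (ρ * inner ℝ z y) := by
    simp only [← Real.exp_add]
    congr 1
    rw [norm_sub_sq_real, norm_smul, norm_smul, real_inner_smul_right, real_inner_comm y z,
      mul_pow, mul_pow, Real.norm_eq_abs, Real.norm_eq_abs, sq_abs, sq_abs]
    linear_combination (-‖z‖ ^ 2 / 2) * hρs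
  simp only [harg, hf, stdGaussianDensity]
  linear_combination ((2 * Real.pi) ^ (-(Module.finrank ℝ E : ℝ) / 2)) ^ 2 * f z y * hexp

end StdGaussianDensity

/-! ### The correlated pair as a linear image of an independent pair. -/

section CorrelatedPair

variable {d : ℕ}

@[fun_prop]
lemma continuous_stack :
    Continuous fun p : EuclideanSpace ℝ (Fin d) × EuclideanSpace ℝ (Fin d) => stack p.1 p.2 := by
  unfold stack
  refine (PiLp.continuous_toLp 2 _).comp (continuous_pi fun i => ?_)
  cases i <;> simp only [Sum.elim_inl, Sum.elim_inr] <;> fun_prop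

lemma stack_surjective (t : EuclideanSpace ℝ (Fin d ⊕ Fin d)) :
    ∃ a b : EuclideanSpace ℝ (Fin d), stack a b = t :=
  ⟨WithLp.toLp 2 fun i => t (Sum.inl i), WithLp.toLp 2 fun i => t (Sum.inr i), by
    ext i; cases i <;> rfl⟩

lemma inner_stack (a b x y : EuclideanSpace ℝ (Fin d)) :
    inner ℝ (stack a b) (stack x y) = (inner ℝ a x + inner ℝ b y : ℝ) := by
  simp [stack, PiLp.inner_apply, Fintype.sum_sum_type]

/-- Block Cholesky factorisation `L Lᵀ` with `L = [[I, 0], [ρI, sI]]`. -/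
lemma corrMatrix_posSemidef {ρ s : ℝ} (hρs : s ^ 2 + ρ ^ 2 = 1) :
    (corrMatrix d ρ).PosSemidef := by
  have h : corrMatrix d ρ = (Matrix.fromBlocks 1 0 (ρ • 1) (s • 1)) *
      (Matrix.fromBlocks 1 0 (ρ • 1) (s • 1) : Matrix (Fin d ⊕ Fin d) (Fin d ⊕ Fin d) ℝ).conjTranspose := by
    rw [Matrix.fromBlocks_conjTranspose, Matrix.fromBlocks_multiply, corrMatrix]
    congr 1 <;> simp
    rw [smul_smul, smul_smul, ← add_smul, show ρ * ρ + s * s = 1 by linarith, one_smul]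
  rw [h]
  exact Matrix.posSemidef_self_mul_conjTranspose _

lemma dotProduct_corrMatrix_mulVec (ρ : ℝ) (a b : EuclideanSpace ℝ (Fin d)) :
    (stack a b).ofLp ⬝ᵥ (corrMatrix d ρ).mulVec (stack a b).ofLp =
      ‖a‖ ^ 2 + 2 * ρ * inner ℝ a b + ‖b‖ ^ 2 := by
  simp only [stack, corrMatrix, Matrix.fromBlocks_mulVec, Matrix.dotProduct_block]
  simp only [EuclideanSpace.real_norm_sq_eq, PiLp.inner_apply, dotProduct, Finset.mul_sum,
    ← Finset.sum_add_distrib]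
  refine Finset.sum_congr rfl fun i _ => ?_
  simp [Matrix.smul_mulVec]
  ring

/-- Characteristic functions agree because `‖a + ρb‖² + s²‖b‖²` is the quadratic form of the
correlation matrix. -/
lemma multivariateGaussian_corrMatrix {ρ s : ℝ} (hρs : s ^ 2 + ρ ^ 2 = 1) :
    multivariateGaussian 0 (corrMatrix d ρ) =
      ((stdGaussian (EuclideanSpace ℝ (Fin d))).prod
        (stdGaussian (EuclideanSpace ℝ (Fin d)))).map
          fun p => stack p.1 (ρ • p.1 + s • p.2) := by
  have hcont : Continuous fun p : EuclideanSpace ℝ (Fin d) × EuclideanSpace ℝ (Fin d) =>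
      stack p.1 (ρ • p.1 + s • p.2) :=
    continuous_stack.comp (by fun_prop : Continuous
      fun p : EuclideanSpace ℝ (Fin d) × EuclideanSpace ℝ (Fin d) => (p.1, ρ • p.1 + s • p.2))
  have hprob := Measure.isProbabilityMeasure_map (μ := (stdGaussian (EuclideanSpace ℝ (Fin d))).prod
        (stdGaussian (EuclideanSpace ℝ (Fin d)))) hcont.aemeasurable
  refine Measure.ext_of_charFun (funext fun t => ?_)
  obtain ⟨a, b, rfl⟩ := stack_surjective t
  rw [charFun_multivariateGaussian (corrMatrix_posSemidef hρs), dotProduct_corrMatrix_mulVec,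
    charFun_apply, integral_map hcont.aemeasurable (by fun_prop)]
  have hsplit (p : EuclideanSpace ℝ (Fin d) × EuclideanSpace ℝ (Fin d)) :
      Complex.exp ((inner ℝ (stack p.1 (ρ • p.1 + s • p.2)) (stack a b) : ℝ) * Complex.I) =
        Complex.exp ((inner ℝ p.1 (a + ρ • b) : ℝ) * Complex.I) *
          Complex.exp ((inner ℝ p.2 (s • b) : ℝ) * Complex.I) := by
    rw [← Complex.exp_add, inner_stack]
    congr 1
    simp only [inner_add_left, inner_add_right, real_inner_smul_left, real_inner_smul_right]
    push_cast
    ring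
  simp_rw [hsplit]
  rw [integral_prod_mul (fun z : EuclideanSpace ℝ (Fin d) =>
      Complex.exp ((inner ℝ z (a + ρ • b) : ℝ) * Complex.I))
    (fun w => Complex.exp ((inner ℝ w (s • b) : ℝ) * Complex.I)), ← charFun_apply,
    ← charFun_apply, charFun_stdGaussian, charFun_stdGaussian, ← Complex.exp_add]
  congr 1
  simp only [← Complex.ofReal_pow]
  rw [norm_add_sq_real, norm_smul, norm_smul, real_inner_smul_right,
      mul_pow, mul_pow, Real.norm_eq_abs, Real.norm_eq_abs, sq_abs, sq_abs]
  have h : (s : ℂ) ^ 2 + (ρ : ℂ) ^ 2 = 1 := by exact_mod_cast hρs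
  push_cast
  simp only [inner_zero_right, Complex.ofReal_zero]
  linear_combination ((‖b‖ : ℂ) ^ 2 / 2) * h

end CorrelatedPair

/-! ### Polar coordinates and one-dimensional Gaussian moments. -/

section Polar

open Set in
lemma integral_Ioi_pow_mul_exp_neg_sq_div_two (n : ℕ) :
    ∫ r in Ioi (0 : ℝ), r ^ n * Real.exp (-r ^ 2 / 2) =
      2 ^ (((n : ℝ) - 1) / 2) * Real.Gamma (((n : ℝ) + 1) / 2) := by
  have h := integral_rpow_mul_exp_neg_mul_rpow (p := 2) (q := n) (b := 1 / 2) (by norm_num)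
    (by linarith [n.cast_nonneg (α := ℝ)]) (by norm_num)
  have hpow : (1 / 2 : ℝ) ^ (-((n : ℝ) + 1) / 2) * (1 / 2) = 2 ^ (((n : ℝ) - 1) / 2) := by
    rw [one_div, Real.inv_rpow (by norm_num), ← Real.rpow_neg (by norm_num),
      ← Real.rpow_neg_one 2, ← Real.rpow_add (by norm_num)]
    congr 1
    ring
  rw [hpow] at h
  rw [← h]
  refine setIntegral_congr_fun measurableSet_Ioi fun r _ => ?_
  simp only [Real.rpow_natCast, Real.rpow_ofNat]
  congr 2
  ring

variable {E : Type*} [NormedAddCommGroup E] [InnerProductSpace ℝ E] [FiniteDimensional ℝ E]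
  [MeasurableSpace E] [BorelSpace E]

open Set Metric in
/-- Gaussian integrals of positively homogeneous functions in polar coordinates. -/
lemma integral_stdGaussian_of_homogeneous [Nontrivial E] (h : E → ℝ) (k : ℕ)
    (hh : ∀ r : ℝ, 0 < r → ∀ x, h (r • x) = r ^ k * h x) :
    ∫ x, h x ∂stdGaussian E =
      (2 * Real.pi) ^ (-(Module.finrank ℝ E : ℝ) / 2) *
        (∫ u : sphere (0 : E) 1, h u ∂(volume : Measure E).toSphere) *
          (2 ^ (((Module.finrank ℝ E : ℝ) + k) / 2 - 1) *
            Real.Gamma (((Module.finrank ℝ E : ℝ) + k) / 2)) := by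
  set n := Module.finrank ℝ E with hn
  have hn1 : 1 ≤ n := Module.finrank_pos
  set κ : ℝ := (2 * Real.pi) ^ (-(n : ℝ) / 2) with hκ
  let F : E → ℝ := fun x => stdGaussianDensity x * h x
  -- The radial measure contributes `r^(n-1)` and homogeneity `r^k`; `1 ≤ n` makes the natural
  -- subtraction exact.
  have hrad := integral_Ioi_pow_mul_exp_neg_sq_div_two (n - 1 + k)
  have hcast : ((n - 1 + k : ℕ) : ℝ) = (n : ℝ) + k - 1 := by push_cast [hn1]; ring
  rw [hcast, show ((n : ℝ) + k - 1 - 1) / 2 = ((n : ℝ) + k) / 2 - 1 by ring,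
    sub_add_cancel] at hrad
  calc ∫ x, h x ∂stdGaussian E = ∫ x, F x := integral_stdGaussian h
    _ = ∫ x : ({(0)}ᶜ : Set E), F x.1 ∂((volume : Measure E).comap (↑)) := by
      rw [integral_subtype_comap (measurableSet_singleton _).compl F,
        restrict_compl_singleton]
    _ = ∫ p, F (p.2.1 • p.1.1) ∂(volume : Measure E).toSphere.prod (.volumeIoiPow (n - 1)) := by
      have := (volume : Measure E).measurePreserving_homeomorphUnitSphereProd.integral_comp
        (Homeomorph.measurableEmbedding _) fun p => F (p.2.1 • p.1.1)
      rw [← this]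
      refine integral_congr_ae (ae_of_all _ fun x => ?_)
      have hx : ‖(x : E)‖ ≠ 0 := norm_ne_zero_iff.mpr x.2
      simp [smul_smul, hx]
    _ = ∫ p, h p.1.1 * (κ * (p.2.1 ^ k * Real.exp (-p.2.1 ^ 2 / 2)))
          ∂(volume : Measure E).toSphere.prod (.volumeIoiPow (n - 1)) := by
      refine integral_congr_ae (ae_of_all _ fun p => ?_)
      have h1 : ‖(p.1 : E)‖ = 1 := by simp
      simp only [F, stdGaussianDensity, hh _ p.2.2, norm_smul, h1, mul_one, Real.norm_eq_abs,
        sq_abs, ← hn, ← hκ]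
      ring
    _ = (∫ u : sphere (0 : E) 1, h u ∂(volume : Measure E).toSphere) *
        ∫ r : Ioi (0 : ℝ), κ * (r.1 ^ k * Real.exp (-r.1 ^ 2 / 2)) ∂.volumeIoiPow (n - 1) :=
      integral_prod_mul (fun u : sphere (0 : E) 1 => h u)
        (fun r : Ioi (0 : ℝ) => κ * (r.1 ^ k * Real.exp (-r.1 ^ 2 / 2)))
    _ = _ := by
      rw [← hrad, mul_comm κ, mul_assoc, integral_const_mul]
      congr 2
      simp only [Measure.volumeIoiPow, ENNReal.ofReal]
      rw [integral_withDensity_eq_integral_smul,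
        integral_subtype_comap measurableSet_Ioi fun a : ℝ =>
          Real.toNNReal (a ^ (n - 1)) • (a ^ k * Real.exp (-a ^ 2 / 2)),
        setIntegral_congr_fun measurableSet_Ioi fun x hx => ?_]
      · rw [NNReal.smul_def, Real.coe_toNNReal _ (pow_nonneg (mem_Ioi.mp hx).le _), smul_eq_mul,
          ← mul_assoc, ← pow_add]
      · exact (measurable_subtype_coe.pow_const _).real_toNNReal

open Metric in
/-- Gaussian integrals of homogeneous functions that agree on the unit sphere. -/
lemma integral_stdGaussian_eq_of_eqOn_sphere [Nontrivial E] {h₁ h₂ : E → ℝ} {a b : ℕ}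
    (hh₁ : ∀ r : ℝ, 0 < r → ∀ x, h₁ (r • x) = r ^ a * h₁ x)
    (hh₂ : ∀ r : ℝ, 0 < r → ∀ x, h₂ (r • x) = r ^ b * h₂ x)
    (heq : ∀ x, ‖x‖ = 1 → h₁ x = h₂ x) :
    ∫ x, h₁ x ∂stdGaussian E =
      2 ^ (((a : ℝ) - b) / 2) * (Real.Gamma (((Module.finrank ℝ E : ℝ) + a) / 2) /
        Real.Gamma (((Module.finrank ℝ E : ℝ) + b) / 2)) * ∫ x, h₂ x ∂stdGaussian E := by
  have hn : (0 : ℝ) < Module.finrank ℝ E := by exact_mod_cast Module.finrank_pos (R := ℝ) (M := E)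
  have hΓ : Real.Gamma (((Module.finrank ℝ E : ℝ) + b) / 2) ≠ 0 :=
    (Real.Gamma_pos_of_pos (by positivity)).ne'
  -- The spherical integrals coincide, so only the radial factors differ.
  have hS : ∫ u : sphere (0 : E) 1, h₁ u ∂(volume : Measure E).toSphere =
      ∫ u : sphere (0 : E) 1, h₂ u ∂(volume : Measure E).toSphere :=
    integral_congr_ae (ae_of_all _ fun u => heq u (by simp))
  have hpow : (2 : ℝ) ^ (((Module.finrank ℝ E : ℝ) + a) / 2 - 1) =
      2 ^ (((a : ℝ) - b) / 2) * 2 ^ (((Module.finrank ℝ E : ℝ) + b) / 2 - 1) := by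
    rw [← Real.rpow_add (by norm_num)]
    congr 1
    ring
  rw [integral_stdGaussian_of_homogeneous h₁ a hh₁, integral_stdGaussian_of_homogeneous h₂ b hh₂,
    hS, hpow]
  field_simp

lemma integral_norm_pow_stdGaussian [Nontrivial E] (k : ℕ) :
    ∫ x, ‖x‖ ^ k ∂stdGaussian E =
      2 ^ ((k : ℝ) / 2) * (Real.Gamma (((Module.finrank ℝ E : ℝ) + k) / 2) /
        Real.Gamma ((Module.finrank ℝ E : ℝ) / 2)) := by
  rw [integral_stdGaussian_eq_of_eqOn_sphere (h₁ := fun x : E => ‖x‖ ^ k) (h₂ := fun _ => 1)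
    (a := k) (b := 0) (fun r hr x => by simp [norm_smul, abs_of_pos hr, mul_pow]) (by simp)
    (fun x hx => by simp [hx])]
  simp

/-- A linear functional of a standard Gaussian is a centred Gaussian with variance `‖y‖²`. -/
lemma integral_inner_pow_stdGaussian (y : E) (n : ℕ) :
    ∫ x, (inner ℝ x y : ℝ) ^ n ∂stdGaussian E = ‖y‖ ^ n * ∫ x, x ^ n ∂gaussianReal 0 1 := by
  have hmap : (stdGaussian E).map (innerSL ℝ y) = (gaussianReal 0 1).map (‖y‖ * ·) := by
    rw [IsGaussian.map_eq_gaussianReal, integral_strongDual_stdGaussian,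
      variance_dual_stdGaussian, innerSL_apply_norm, gaussianReal_map_const_mul]
    congr 1
    · simp
    · ext; simp
  calc ∫ x, (inner ℝ x y : ℝ) ^ n ∂stdGaussian E
      = ∫ t, t ^ n ∂(stdGaussian E).map (innerSL ℝ y) := by
        rw [integral_map (by fun_prop) (by fun_prop)]
        simp [real_inner_comm]
    _ = _ := by
        rw [hmap, integral_map (by fun_prop) (by fun_prop), ← integral_const_mul]
        simp [mul_pow]

lemma integral_pow_gaussianReal_of_odd {n : ℕ} (hn : Odd n) :
    ∫ x, x ^ n ∂gaussianReal 0 1 = 0 := by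
  have h : ∫ x, x ^ n ∂gaussianReal 0 1 = -∫ x, x ^ n ∂gaussianReal 0 1 := by
    conv_lhs => rw [← neg_zero, ← gaussianReal_map_neg, integral_map (by fun_prop) (by fun_prop)]
    simp [hn.neg_pow, integral_neg]
  linarith

lemma integral_pow_gaussianReal_of_even {n : ℕ} (hn : Even n) :
    ∫ x, x ^ n ∂gaussianReal 0 1 =
      2 ^ ((n : ℝ) / 2) * Real.Gamma (((n : ℝ) + 1) / 2) / √Real.pi := by
  rw [integral_gaussianReal_eq_integral_smul one_ne_zero]
  have h (x : ℝ) : gaussianPDFReal 0 1 x • x ^ n =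
      (√(2 * Real.pi))⁻¹ * (|x| ^ n * Real.exp (-|x| ^ 2 / 2)) := by
    simp [gaussianPDFReal, hn.pow_abs]
    ring
  simp_rw [h]
  rw [integral_const_mul, integral_comp_abs (f := fun x => x ^ n * Real.exp (-x ^ 2 / 2)),
    integral_Ioi_pow_mul_exp_neg_sq_div_two, Real.sqrt_mul (by norm_num), Real.sqrt_eq_rpow 2]
  have hpow : (2 : ℝ) ^ ((n : ℝ) / 2) = 2 ^ (((n : ℝ) - 1) / 2) * 2 ^ (1 / 2 : ℝ) := by
    rw [← Real.rpow_add (by norm_num)]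
    congr 1
    ring
  have htwo : (2 : ℝ) ^ (1 / 2 : ℝ) * 2 ^ (1 / 2 : ℝ) = 2 := by
    rw [← Real.rpow_add (by norm_num)]; norm_num
  rw [hpow]
  field_simp
  rw [sq, htwo]

end Polar

/-! ### The cosine and its mixed moments with the inner product. -/

section CosSim

variable {d : ℕ}

lemma cosSim_eq (x y : EuclideanSpace ℝ (Fin d)) :
    cosSim x y = ‖x‖⁻¹ * ‖y‖⁻¹ * inner ℝ x y := by
  rw [cosSim, real_inner_smul_left, real_inner_smul_right]; ring

/-- Cauchy–Schwarz; if a vector is zero, the convention `0⁻¹ = 0` makes the cosine `0`, so no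
nonvanishing is needed. -/
lemma abs_cosSim_le_one (x y : EuclideanSpace ℝ (Fin d)) : |cosSim x y| ≤ 1 := by
  rw [cosSim_eq, abs_mul, abs_of_nonneg (by positivity), ← mul_inv, inv_mul_eq_div]
  exact div_le_one_of_le₀ (abs_real_inner_le_norm x y) (by positivity)

lemma abs_cosSim_pow_le_one (x y : EuclideanSpace ℝ (Fin d)) (m : ℕ) : |cosSim x y ^ m| ≤ 1 := by
  rw [abs_pow]; exact pow_le_one₀ (abs_nonneg _) (abs_cosSim_le_one x y)

lemma cosSim_smul_left {r : ℝ} (hr : 0 < r) (x y : EuclideanSpace ℝ (Fin d)) :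
    cosSim (r • x) y = cosSim x y := by
  rw [cosSim_eq, cosSim_eq, norm_smul, Real.norm_of_nonneg hr.le, real_inner_smul_left]
  field_simp

lemma cosSim_comm (x y : EuclideanSpace ℝ (Fin d)) : cosSim x y = cosSim y x := by
  rw [cosSim, cosSim, real_inner_comm]

@[fun_prop]
lemma measurable_cosSim :
    Measurable fun p : EuclideanSpace ℝ (Fin d) × EuclideanSpace ℝ (Fin d) =>
      cosSim p.1 p.2 := by
  simp only [cosSim_eq]; fun_prop

/-- Mixed moments of the cosine and the inner product of two independent standard Gaussian
vectors. -/
lemma integral_cosSim_pow_mul_inner_pow (hd : 1 ≤ d) (m k : ℕ) :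
    ∫ z, ∫ y, cosSim z y ^ m * (inner ℝ z y : ℝ) ^ k ∂stdGaussian (EuclideanSpace ℝ (Fin d))
        ∂stdGaussian (EuclideanSpace ℝ (Fin d)) =
      2 ^ (((k : ℝ) - m) / 2) * (Real.Gamma (((d : ℝ) + k) / 2) ^ 2 /
        (Real.Gamma (((d : ℝ) + k + m) / 2) * Real.Gamma ((d : ℝ) / 2))) *
          ∫ x, x ^ (k + m) ∂gaussianReal 0 1 := by
  have : Nonempty (Fin d) := ⟨⟨0, hd⟩⟩
  have hinner (z : EuclideanSpace ℝ (Fin d)) (hz : z ≠ 0) :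
      ∫ y, cosSim z y ^ m * (inner ℝ z y : ℝ) ^ k ∂stdGaussian (EuclideanSpace ℝ (Fin d)) =
        2 ^ (-(m : ℝ) / 2) * (Real.Gamma (((d : ℝ) + k) / 2) /
          Real.Gamma (((d : ℝ) + k + m) / 2)) * (∫ x, x ^ (k + m) ∂gaussianReal 0 1) *
            ‖z‖ ^ k := by
    rw [integral_stdGaussian_eq_of_eqOn_sphere
      (h₁ := fun y => cosSim z y ^ m * (inner ℝ z y : ℝ) ^ k)
      (h₂ := fun y => ‖z‖⁻¹ ^ m * (inner ℝ y z : ℝ) ^ (k + m)) (a := k) (b := k + m)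
      (fun r hr y => by
        rw [cosSim_comm, cosSim_smul_left hr, cosSim_comm, real_inner_smul_right]; ring)
      (fun r hr y => by rw [real_inner_smul_left]; ring)
      (fun y hy => by
        rw [cosSim_eq, hy, real_inner_comm]; ring),
      integral_const_mul, integral_inner_pow_stdGaussian]
    have hz' : ‖z‖ ≠ 0 := norm_ne_zero_iff.mpr hz
    simp only [finrank_euclideanSpace, Fintype.card_fin]
    push_cast
    rw [show ((k : ℝ) - (k + m)) / 2 = -(m : ℝ) / 2 by ring, ← add_assoc, pow_add ‖z‖]
    rw [inv_pow]
    field_simp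
  -- The formula for the inner integral can fail at `z = 0` (for `k = 0` and even `m > 0`); the
  -- origin is a null set since `d ≥ 1`.
  have hne : ∀ᵐ z ∂stdGaussian (EuclideanSpace ℝ (Fin d)), z ≠ 0 := by
    rw [stdGaussian_eq_withDensity]
    exact (withDensity_absolutelyContinuous _ _).ae_le (Measure.ae_ne volume 0)
  rw [integral_congr_ae (hne.mono hinner), integral_const_mul, integral_norm_pow_stdGaussian]
  simp only [finrank_euclideanSpace, Fintype.card_fin]
  rw [show ((k : ℝ) - m) / 2 = -(m : ℝ) / 2 + (k : ℝ) / 2 by ring, Real.rpow_add (by norm_num)]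
  field_simp

end CosSim

/-! ### Expansion in powers of `ρ` and identification with `₃F₂`. -/

section Series

variable {d : ℕ}

/-- By AM–GM the exponent is at most `(c/2)(‖x‖² + ‖y‖²)`, and `c/2 < 1/2` is exactly what the
Gaussian density absorbs. -/
lemma integrable_exp_mul_norm_mul_norm {E : Type*} [NormedAddCommGroup E] [InnerProductSpace ℝ E]
    [FiniteDimensional ℝ E] [MeasurableSpace E] [BorelSpace E] {c : ℝ} (hc0 : 0 ≤ c) (hc : c < 1) :
    Integrable (fun p : E × E => Real.exp (c * (‖p.1‖ * ‖p.2‖)))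
      ((stdGaussian E).prod (stdGaussian E)) := by
  have h := integrable_exp_mul_sq_norm_stdGaussian (E := E) (c := c / 2) (by linarith)
  refine (h.mul_prod h).mono' (by fun_prop) (ae_of_all _ fun p => ?_)
  rw [Real.norm_of_nonneg (Real.exp_pos _).le, ← Real.exp_add]
  gcongr
  nlinarith [mul_nonneg hc0 (sq_nonneg (‖p.1‖ - ‖p.2‖))]

lemma norm_cosSim_pow_mul_le (ρ : ℝ) (m k : ℕ) (z y : EuclideanSpace ℝ (Fin d)) :
    ‖cosSim z y ^ m * ((ρ * inner ℝ z y) ^ k / k.factorial)‖ ≤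
      (|ρ| * (‖z‖ * ‖y‖)) ^ k / k.factorial := by
  rw [norm_mul, norm_div, norm_pow (ρ * _), norm_mul ρ, Real.norm_natCast]
  refine (mul_le_of_le_one_left (by positivity) (abs_cosSim_pow_le_one z y m)).trans ?_
  gcongr
  · exact le_rfl
  · exact abs_real_inner_le_norm z y

lemma integrable_cosSim_pow_mul_pow_div_factorial (m k : ℕ) {ρ : ℝ} (hρ : |ρ| < 1) :
    Integrable (fun p : EuclideanSpace ℝ (Fin d) × EuclideanSpace ℝ (Fin d) =>
      cosSim p.1 p.2 ^ m * ((ρ * inner ℝ p.1 p.2) ^ k / k.factorial))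
        ((stdGaussian (EuclideanSpace ℝ (Fin d))).prod
          (stdGaussian (EuclideanSpace ℝ (Fin d)))) :=
  (integrable_exp_mul_norm_mul_norm (abs_nonneg ρ) hρ).mono' (by fun_prop)
    (ae_of_all _ fun p => (norm_cosSim_pow_mul_le ρ m k p.1 p.2).trans
      (Real.pow_div_factorial_le_exp _ (by positivity) k))

lemma integrable_cosSim_pow_mul_exp (m : ℕ) {ρ : ℝ} (hρ : |ρ| < 1) :
    Integrable (fun p : EuclideanSpace ℝ (Fin d) × EuclideanSpace ℝ (Fin d) =>
      cosSim p.1 p.2 ^ m * Real.exp (ρ * inner ℝ p.1 p.2))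
        ((stdGaussian (EuclideanSpace ℝ (Fin d))).prod
          (stdGaussian (EuclideanSpace ℝ (Fin d)))) := by
  refine (integrable_exp_mul_norm_mul_norm (abs_nonneg ρ) hρ).mono' (by fun_prop)
    (ae_of_all _ fun p => ?_)
  rw [norm_mul, Real.norm_of_nonneg (Real.exp_pos _).le]
  refine (mul_le_of_le_one_left (by positivity) (abs_cosSim_pow_le_one p.1 p.2 m)).trans ?_
  refine Real.exp_le_exp.mpr ((le_abs_self _).trans ?_)
  rw [abs_mul]
  gcongr
  exact abs_real_inner_le_norm _ _

lemma hasSum_integral_prod_cosSim_pow (m : ℕ) {ρ : ℝ} (hρ : |ρ| < 1) :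
    HasSum (fun k : ℕ => ∫ p, cosSim p.1 p.2 ^ m * ((ρ * inner ℝ p.1 p.2) ^ k / k.factorial)
        ∂(stdGaussian (EuclideanSpace ℝ (Fin d))).prod (stdGaussian (EuclideanSpace ℝ (Fin d))))
      (∫ p, cosSim p.1 p.2 ^ m * Real.exp (ρ * inner ℝ p.1 p.2)
        ∂(stdGaussian (EuclideanSpace ℝ (Fin d))).prod
          (stdGaussian (EuclideanSpace ℝ (Fin d)))) := by
  have hsum (t : ℝ) : HasSum (fun k : ℕ => t ^ k / k.factorial) (Real.exp t) := by
    rw [Real.exp_eq_exp_ℝ]; exact NormedSpace.expSeries_div_hasSum_exp t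
  refine hasSum_integral_of_dominated_convergence
    (fun k p => (|ρ| * (‖p.1‖ * ‖p.2‖)) ^ k / k.factorial) (fun k => ?_) (fun k => ?_) ?_ ?_ ?_
  · exact (integrable_cosSim_pow_mul_pow_div_factorial m k hρ).aestronglyMeasurable
  · exact ae_of_all _ fun p => norm_cosSim_pow_mul_le ρ m k p.1 p.2
  · exact ae_of_all _ fun p => (hsum _).summable
  · simp only [(hsum _).tsum_eq]
    exact integrable_exp_mul_norm_mul_norm (abs_nonneg ρ) hρ
  · exact ae_of_all _ fun p => (hsum (ρ * inner ℝ p.1 p.2)).mul_left (cosSim p.1 p.2 ^ m)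

/-- Expansion of the exponentially weighted cosine moment in powers of the correlation. -/
lemma hasSum_integral_cosSim_pow (m : ℕ) {ρ : ℝ} (hρ : |ρ| < 1) :
    HasSum (fun k : ℕ => ρ ^ k / k.factorial *
        ∫ z, ∫ y, cosSim z y ^ m * (inner ℝ z y : ℝ) ^ k ∂stdGaussian (EuclideanSpace ℝ (Fin d))
          ∂stdGaussian (EuclideanSpace ℝ (Fin d)))
      (∫ z, ∫ y, cosSim z y ^ m * Real.exp (ρ * inner ℝ z y)
        ∂stdGaussian (EuclideanSpace ℝ (Fin d)) ∂stdGaussian (EuclideanSpace ℝ (Fin d))) := by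
  have h := hasSum_integral_prod_cosSim_pow (d := d) m hρ
  rw [integral_prod _ (integrable_cosSim_pow_mul_exp m hρ)] at h
  refine (congrArg (HasSum · _) (funext fun k => ?_)).mpr h
  rw [integral_prod _ (integrable_cosSim_pow_mul_pow_div_factorial m k hρ), ← integral_const_mul]
  refine integral_congr_ae (ae_of_all _ fun z => ?_)
  simp only [← integral_const_mul]
  refine integral_congr_ae (ae_of_all _ fun y => ?_)
  simp only [mul_pow]
  ring

lemma ascPochhammer_eval_mul_Gamma {x : ℝ} (hx : 0 < x) (n : ℕ) :
    (ascPochhammer ℝ n).eval x * Real.Gamma x = Real.Gamma (x + n) := by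
  induction n with
  | zero => simp
  | succ n ih =>
    rw [ascPochhammer_succ_eval, Nat.cast_succ, ← add_assoc, Real.Gamma_add_one (by positivity),
      ← ih]
    ring

/-- Source of the lower parameter `1/2`: the factor `4^n` cancels the `2^k` of the coefficient with
`k = 2n`, and `n!` is the one in the series. -/
lemma factorial_two_mul_eq_ascPochhammer (n : ℕ) :
    ((2 * n).factorial : ℝ) = 4 ^ n * n.factorial * (ascPochhammer ℝ n).eval (1 / 2) := by
  induction n with
  | zero => simp
  | succ n ih =>
    rw [ascPochhammer_succ_eval, Nat.mul_succ, Nat.factorial_succ, Nat.factorial_succ,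
      Nat.factorial_succ]
    push_cast
    rw [ih]
    ring

/-- Source of the lower parameter `3/2`; with `k = 2n + 1` one factor `2` is left over and enters
`cMinus`. -/
lemma factorial_two_mul_add_one_eq_ascPochhammer (n : ℕ) :
    ((2 * n + 1).factorial : ℝ) = 4 ^ n * n.factorial * (ascPochhammer ℝ n).eval (3 / 2) := by
  induction n with
  | zero => simp
  | succ n ih =>
    rw [ascPochhammer_succ_eval, Nat.mul_succ, show 2 * n + 2 + 1 = (2 * n + 1) + 1 + 1 by ring,
      Nat.factorial_succ, Nat.factorial_succ, Nat.factorial_succ n]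
    push_cast
    rw [ih]
    ring

/-- Closed form of the nonvanishing coefficients of the expansion. -/
lemma integral_cosSim_pow_mul_inner_pow_of_even (hd : 1 ≤ d) {m k : ℕ} (hkm : Even (k + m)) :
    ∫ z, ∫ y, cosSim z y ^ m * (inner ℝ z y : ℝ) ^ k ∂stdGaussian (EuclideanSpace ℝ (Fin d))
        ∂stdGaussian (EuclideanSpace ℝ (Fin d)) =
      2 ^ k * Real.Gamma (((d : ℝ) + k) / 2) ^ 2 * Real.Gamma (((k : ℝ) + m + 1) / 2) /
        (√Real.pi * Real.Gamma (((d : ℝ) + k + m) / 2) * Real.Gamma ((d : ℝ) / 2)) := by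
  rw [integral_cosSim_pow_mul_inner_pow hd, integral_pow_gaussianReal_of_even hkm]
  have h2 : (2 : ℝ) ^ k = 2 ^ (((k : ℝ) - m) / 2) * 2 ^ (((k + m : ℕ) : ℝ) / 2) := by
    rw [← Real.rpow_natCast, ← Real.rpow_add (by norm_num)]
    congr 1
    push_cast
    ring
  rw [h2]
  push_cast
  field_simp

lemma integral_cosSim_pow_mul_inner_pow_of_odd (hd : 1 ≤ d) {m k : ℕ} (hkm : Odd (k + m)) :
    ∫ z, ∫ y, cosSim z y ^ m * (inner ℝ z y : ℝ) ^ k ∂stdGaussian (EuclideanSpace ℝ (Fin d))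
        ∂stdGaussian (EuclideanSpace ℝ (Fin d)) = 0 := by
  rw [integral_cosSim_pow_mul_inner_pow hd, integral_pow_gaussianReal_of_odd hkm, mul_zero]

lemma hasSum_even_moment (hd : 1 ≤ d) {m : ℕ} (hm : Even m) {ρ : ℝ} (hρ : |ρ| < 1) :
    HasSum (fun j => cPlus d m * hyp3F2Term ((d : ℝ) / 2) ((d : ℝ) / 2) (((m : ℝ) + 1) / 2)
        (1 / 2) (((m : ℝ) + d) / 2) (ρ ^ 2) j)
      (∫ z, ∫ y, cosSim z y ^ m * Real.exp (ρ * inner ℝ z y)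
        ∂stdGaussian (EuclideanSpace ℝ (Fin d)) ∂stdGaussian (EuclideanSpace ℝ (Fin d))) := by
  have hd0 : (0 : ℝ) < d := by exact_mod_cast hd
  have h := hasSum_integral_cosSim_pow (d := d) m hρ
  -- Terms with odd `k` vanish, so the sum runs over `k = 2j`.
  rw [← Function.Injective.hasSum_iff (g := fun j : ℕ => 2 * j)
    (mul_right_injective₀ two_ne_zero)] at h
  · convert! h using 2 with j
    rw [Function.comp_apply,
      integral_cosSim_pow_mul_inner_pow_of_even hd ((even_two_mul j).add hm),
      factorial_two_mul_eq_ascPochhammer, hyp3F2Term, cPlus]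
    push_cast
    rw [show ((d : ℝ) + 2 * j) / 2 = (d : ℝ) / 2 + j by ring,
      show (2 * (j : ℝ) + m + 1) / 2 = ((m : ℝ) + 1) / 2 + j by ring,
      show ((d : ℝ) + 2 * j + m) / 2 = ((m : ℝ) + d) / 2 + j by ring,
      ← ascPochhammer_eval_mul_Gamma (by positivity), ← ascPochhammer_eval_mul_Gamma (by positivity),
      ← ascPochhammer_eval_mul_Gamma (by positivity), pow_mul, pow_mul]
    have h1 : (ascPochhammer ℝ j).eval (((m : ℝ) + d) / 2) ≠ 0 :=
      (ascPochhammer_pos _ _ (by positivity)).ne'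
    have h2 : (ascPochhammer ℝ j).eval (1 / 2 : ℝ) ≠ 0 :=
      (ascPochhammer_pos _ _ (by positivity)).ne'
    have h3 : Real.Gamma ((d : ℝ) / 2) ≠ 0 := (Real.Gamma_pos_of_pos (by positivity)).ne'
    have h4 : Real.Gamma (((m : ℝ) + d) / 2) ≠ 0 := (Real.Gamma_pos_of_pos (by positivity)).ne'
    rw [show (2 : ℝ) ^ 2 = 4 by norm_num]
    field_simp
  · intro k hk
    have hodd : Odd k := by
      rw [← Nat.not_even_iff_odd]
      rintro ⟨j, rfl⟩
      exact hk ⟨j, two_mul j⟩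
    rw [integral_cosSim_pow_mul_inner_pow_of_odd hd (hodd.add_even hm), mul_zero]

lemma hasSum_odd_moment (hd : 1 ≤ d) {m : ℕ} (hm : Odd m) {ρ : ℝ} (hρ : |ρ| < 1) :
    HasSum (fun j => cMinus d m * ρ *
        hyp3F2Term (((d : ℝ) + 1) / 2) (((d : ℝ) + 1) / 2) (((m : ℝ) + 2) / 2)
          (3 / 2) (((m : ℝ) + d + 1) / 2) (ρ ^ 2) j)
      (∫ z, ∫ y, cosSim z y ^ m * Real.exp (ρ * inner ℝ z y)
        ∂stdGaussian (EuclideanSpace ℝ (Fin d)) ∂stdGaussian (EuclideanSpace ℝ (Fin d))) := by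
  have hd0 : (0 : ℝ) < d := by exact_mod_cast hd
  have h := hasSum_integral_cosSim_pow (d := d) m hρ
  -- Only `k = 2j + 1` survives; the extra power of `ρ` is the prefactor `ρ`.
  rw [← Function.Injective.hasSum_iff (g := fun j : ℕ => 2 * j + 1)
    ((add_left_injective 1).comp (mul_right_injective₀ two_ne_zero))] at h
  · convert! h using 2 with j
    rw [Function.comp_apply,
      integral_cosSim_pow_mul_inner_pow_of_even hd ((odd_two_mul_add_one j).add_odd hm),
      factorial_two_mul_add_one_eq_ascPochhammer, hyp3F2Term, cMinus]
    push_cast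
    rw [show ((d : ℝ) + (2 * j + 1)) / 2 = ((d : ℝ) + 1) / 2 + j by ring,
      show (2 * (j : ℝ) + 1 + m + 1) / 2 = ((m : ℝ) + 2) / 2 + j by ring,
      show ((d : ℝ) + (2 * j + 1) + m) / 2 = ((m : ℝ) + d + 1) / 2 + j by ring,
      ← ascPochhammer_eval_mul_Gamma (by positivity), ← ascPochhammer_eval_mul_Gamma (by positivity),
      ← ascPochhammer_eval_mul_Gamma (by positivity), pow_succ ρ (2 * j),
      pow_succ 2 (2 * j), pow_mul, pow_mul]
    have h1 : (ascPochhammer ℝ j).eval (((m : ℝ) + d + 1) / 2) ≠ 0 :=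
      (ascPochhammer_pos _ _ (by positivity)).ne'
    have h2 : (ascPochhammer ℝ j).eval (3 / 2 : ℝ) ≠ 0 :=
      (ascPochhammer_pos _ _ (by positivity)).ne'
    have h3 : Real.Gamma ((d : ℝ) / 2) ≠ 0 := (Real.Gamma_pos_of_pos (by positivity)).ne'
    have h4 : Real.Gamma (((m : ℝ) + d + 1) / 2) ≠ 0 := (Real.Gamma_pos_of_pos (by positivity)).ne'
    rw [show (2 : ℝ) ^ 2 = 4 by norm_num]
    field_simp
  · intro k hk
    have heven : Even k := by
      rw [← Nat.not_odd_iff_even]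
      rintro ⟨j, rfl⟩
      exact hk ⟨j, rfl⟩
    rw [integral_cosSim_pow_mul_inner_pow_of_odd hd (heven.add_odd hm), mul_zero]

lemma summable_hyp3F2Term_zero (a₁ a₂ a₃ b₁ b₂ : ℝ) :
    Summable (hyp3F2Term a₁ a₂ a₃ b₁ b₂ 0) := by
  refine summable_of_ne_finset_zero (s := {0}) fun n hn => ?_
  simp [hyp3F2Term, Finset.notMem_singleton.mp hn]

/-- The cosine moments of a correlated Gaussian pair as exponentially weighted moments of an
independent pair. -/
lemma integral_cosSim_pow_of_hasLaw {Ω : Type*} [MeasurableSpace Ω] {P : Measure Ω}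
    {ρ : ℝ} (hρ : |ρ| < 1) {X Y : Ω → EuclideanSpace ℝ (Fin d)}
    (hXY : HasLaw (fun ω => stack (X ω) (Y ω)) (multivariateGaussian 0 (corrMatrix d ρ)) P)
    (m : ℕ) :
    ∫ ω, cosSim (X ω) (Y ω) ^ m ∂P = (1 - ρ ^ 2) ^ ((d : ℝ) / 2) *
      ∫ z, ∫ y, cosSim z y ^ m * Real.exp (ρ * inner ℝ z y)
        ∂stdGaussian (EuclideanSpace ℝ (Fin d)) ∂stdGaussian (EuclideanSpace ℝ (Fin d)) := by
  set γ := stdGaussian (EuclideanSpace ℝ (Fin d))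
  have hpos : 0 < 1 - ρ ^ 2 := by
    have := (sq_lt_one_iff_abs_lt_one ρ).mpr hρ
    linarith
  set s := √(1 - ρ ^ 2) with hs_def
  have hs : 0 < s := Real.sqrt_pos.mpr hpos
  have hρs : s ^ 2 + ρ ^ 2 = 1 := by rw [hs_def, Real.sq_sqrt hpos.le]; ring
  -- The moment must be a function of the stacked vector, whose law alone is given.
  let g : EuclideanSpace ℝ (Fin d ⊕ Fin d) → ℝ := fun t =>
    cosSim (WithLp.toLp 2 fun i => t (Sum.inl i)) (WithLp.toLp 2 fun i => t (Sum.inr i)) ^ m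
  have hg : Measurable g := by
    refine Measurable.pow_const (measurable_cosSim.comp (g := fun p => cosSim p.1 p.2)
      (f := fun t : EuclideanSpace ℝ (Fin d ⊕ Fin d) =>
        ((WithLp.toLp 2 fun i => t (Sum.inl i) : EuclideanSpace ℝ (Fin d)),
          (WithLp.toLp 2 fun i => t (Sum.inr i) : EuclideanSpace ℝ (Fin d)))) ?_) m
    fun_prop
  have hgstack (x y : EuclideanSpace ℝ (Fin d)) : g (stack x y) = cosSim x y ^ m := rfl
  have hcont : Continuous fun p : EuclideanSpace ℝ (Fin d) × EuclideanSpace ℝ (Fin d) =>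
      stack p.1 (ρ • p.1 + s • p.2) :=
    continuous_stack.comp (by fun_prop : Continuous
      fun p : EuclideanSpace ℝ (Fin d) × EuclideanSpace ℝ (Fin d) => (p.1, ρ • p.1 + s • p.2))
  have hint : Integrable (fun p : EuclideanSpace ℝ (Fin d) × EuclideanSpace ℝ (Fin d) =>
      g (stack p.1 (ρ • p.1 + s • p.2))) (γ.prod γ) :=
    Integrable.of_bound (hg.comp hcont.measurable).aestronglyMeasurable 1
      (ae_of_all _ fun p => abs_cosSim_pow_le_one _ _ m)
  calc ∫ ω, cosSim (X ω) (Y ω) ^ m ∂P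
      = ∫ t, g t ∂multivariateGaussian 0 (corrMatrix d ρ) := by
        rw [← hXY.map_eq, integral_map hXY.aemeasurable hg.aestronglyMeasurable]
        rfl
    _ = ∫ z, ∫ w, cosSim z (ρ • z + s • w) ^ m ∂γ ∂γ := by
        rw [multivariateGaussian_corrMatrix hρs, integral_map hcont.aemeasurable
          hg.aestronglyMeasurable, integral_prod _ hint]
        rfl
    _ = _ := by
        rw [integral_shear_stdGaussian hs hρs (fun x y => cosSim x y ^ m) fun x y => by
          rw [cosSim_smul_left hs, cosSim_comm, cosSim_smul_left hs, cosSim_comm],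
          finrank_euclideanSpace, Fintype.card_fin, hs_def, Real.sqrt_eq_rpow,
          ← Real.rpow_mul_natCast hpos.le, one_div_mul_eq_div]

end Series

/-! ### The moment formulas. -/

theorem mainTheorem6 {Ω : Type*} [MeasurableSpace Ω] (P : Measure Ω) [IsProbabilityMeasure P]
    (d m : ℕ) (hd : 1 ≤ d) (ρ : ℝ) (hρ : ρ ∈ Set.Ioo (-1 : ℝ) 1)
    (X Y : Ω → EuclideanSpace ℝ (Fin d))
    (hXY : HasLaw (fun ω => stack (X ω) (Y ω)) (multivariateGaussian 0 (corrMatrix d ρ)) P) :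
    Integrable (fun ω => cosSim (X ω) (Y ω) ^ m) P ∧
    (Odd m →
      Summable (hyp3F2Term (((d : ℝ) + 1) / 2) (((d : ℝ) + 1) / 2) (((m : ℝ) + 2) / 2)
        (3 / 2) (((m : ℝ) + d + 1) / 2) (ρ ^ 2)) ∧
      -1 ≤ ∫ ω, cosSim (X ω) (Y ω) ^ m ∂P ∧
      ∫ ω, cosSim (X ω) (Y ω) ^ m ∂P = oddMoment d m ρ ∧
      oddMoment d m ρ ≤ 1) ∧
    (Even m →
      Summable (hyp3F2Term ((d : ℝ) / 2) ((d : ℝ) / 2) (((m : ℝ) + 1) / 2)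
        (1 / 2) (((m : ℝ) + d) / 2) (ρ ^ 2)) ∧
      -1 ≤ ∫ ω, cosSim (X ω) (Y ω) ^ m ∂P ∧
      ∫ ω, cosSim (X ω) (Y ω) ^ m ∂P = evenMoment d m ρ ∧
      evenMoment d m ρ ≤ 1) := by
  have hd0 : (0 : ℝ) < d := by exact_mod_cast hd
  have hρ' : |ρ| < 1 := abs_lt.mpr hρ
  have hbound : |∫ ω, cosSim (X ω) (Y ω) ^ m ∂P| ≤ 1 := by
    simpa using norm_integral_le_of_norm_le_const (μ := P) (C := 1)
      (f := fun ω => cosSim (X ω) (Y ω) ^ m) (ae_of_all _ fun ω => abs_cosSim_pow_le_one (X ω) (Y ω) m)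
  have hlaw := integral_cosSim_pow_of_hasLaw hρ' hXY m
  refine ⟨?_, fun hm => ?_, fun hm => ?_⟩
  · have hmeas : AEMeasurable (fun ω => (X ω, Y ω)) P := by
      have h := hXY.aemeasurable
      have hX : Measurable fun t : EuclideanSpace ℝ (Fin d ⊕ Fin d) =>
          ((WithLp.toLp 2 fun i => t (Sum.inl i) : EuclideanSpace ℝ (Fin d)),
            (WithLp.toLp 2 fun i => t (Sum.inr i) : EuclideanSpace ℝ (Fin d))) := by fun_prop
      exact hX.comp_aemeasurable h
    exact Integrable.of_bound
      ((measurable_cosSim.comp_aemeasurable hmeas).pow_const m).aestronglyMeasurable 1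
      (ae_of_all _ fun ω => abs_cosSim_pow_le_one (X ω) (Y ω) m)
  · have hsum := hasSum_odd_moment hd hm hρ'
    have heq : ∫ ω, cosSim (X ω) (Y ω) ^ m ∂P = oddMoment d m ρ := by
      rw [hlaw, ← hsum.tsum_eq, tsum_mul_left, oddMoment, hyp3F2]
      ring
    refine ⟨?_, (abs_le.mp hbound).1, heq, heq ▸ (abs_le.mp hbound).2⟩
    -- The known sum carries a factor `ρ`, which cannot be cancelled at `ρ = 0`; there the series
    -- reduces to its term of index `0`.
    rcases eq_or_ne ρ 0 with rfl | hρ0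
    · rw [zero_pow two_ne_zero]
      exact summable_hyp3F2Term_zero _ _ _ _ _
    · have hc : cMinus d m ≠ 0 := by
        have h1 := Real.Gamma_pos_of_pos (show 0 < ((d : ℝ) + 1) / 2 by positivity)
        have h2 := Real.Gamma_pos_of_pos (show 0 < ((m : ℝ) + 2) / 2 by positivity)
        have h3 := Real.Gamma_pos_of_pos (show 0 < (d : ℝ) / 2 by positivity)
        have h4 := Real.Gamma_pos_of_pos (show 0 < ((m : ℝ) + d + 1) / 2 by positivity)
        unfold cMinus
        positivity
      exact (summable_mul_left_iff (mul_ne_zero hc hρ0)).mp hsum.summable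
  · have hsum := hasSum_even_moment hd hm hρ'
    have heq : ∫ ω, cosSim (X ω) (Y ω) ^ m ∂P = evenMoment d m ρ := by
      rw [hlaw, ← hsum.tsum_eq, tsum_mul_left, evenMoment, hyp3F2]
      ring
    refine ⟨?_, (abs_le.mp hbound).1, heq, heq ▸ (abs_le.mp hbound).2⟩
    have hc : cPlus d m ≠ 0 := by
      have h1 := Real.Gamma_pos_of_pos (show 0 < (d : ℝ) / 2 by positivity)
      have h2 := Real.Gamma_pos_of_pos (show 0 < ((m : ℝ) + 1) / 2 by positivity)
      have h3 := Real.Gamma_pos_of_pos (show 0 < ((m : ℝ) + d) / 2 by positivity)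
      unfold cPlus
      positivity
    exact (summable_mul_left_iff hc).mp hsum.summable
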